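/- Let $G$ be a Hausdorff topological group. Call $G$ *feathered* if it contains a non-empty compact set $K$ of countable character, i.e. there is a countable family $\mathcal B$ of open sets containing $K$ such that every open set containing $K$ contains a member of $\mathcal B$. Call $G$ *$S\mathcal M$-factorizable* if for every continuous map $f:G\to M$ to a metrizable space $M$ there exist a continuous homomorphism $\pi:G\to H$ onto a metrizable topological group $H$ and a continuous map $g:H\to M$ with $f=g\circ\pi$. Call $G$ *$PS\mathcal M$-factorizable* if in this definition $\pi$ can always be chosen perfect, i.e. continuous, closed, onto, and with compact fibers. Then $G$ is $PS\mathcal M$-factorizable if and only if $G$ is feathered and $S\mathcal M$-factorizable. -/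

import Mathlib

open TopologicalSpace

universe u

/-- A perfect map: continuous, closed, onto, with compact fibers. -/
structure IsPerfectMap {X Y : Type*} [TopologicalSpace X] [TopologicalSpace Y]
    (f : X → Y) : Prop where
  continuous : Continuous f
  isClosedMap : IsClosedMap f
  surjective : Function.Surjective f
  isCompact_fiber : ∀ y : Y, IsCompact (f ⁻¹' {y})

/-- The subset `K` has countable character in `X`: there is a countable family of open
neighborhoods of `K` such that every open neighborhood of `K` contains one of them. -/
def HasCountableCharacter {X : Type*} [TopologicalSpace X] (K : Set X) : Prop :=
  ∃ B : Set (Set X), B.Countable ∧ (∀ U ∈ B, IsOpen U ∧ K ⊆ U) ∧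
    ∀ W : Set X, IsOpen W → K ⊆ W → ∃ U ∈ B, U ⊆ W

/-- A topological group is feathered if it contains a non-empty compact set of countable
character. -/
def IsFeathered (G : Type*) [TopologicalSpace G] : Prop :=
  ∃ K : Set G, K.Nonempty ∧ IsCompact K ∧ HasCountableCharacter K

/-- Strongly `M`-factorizable groups: every continuous map to a metrizable space factors as a
continuous homomorphism onto a metrizable topological group followed by a continuous map.
Taking `M` and `H` in the universe of `G` is no restriction, since `H` is an image of `G` and `M`
may be replaced by the image of `f`. -/
def IsSMFactorizable (G : Type u) [Group G] [TopologicalSpace G] : Prop :=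
  ∀ (M : Type u) [TopologicalSpace M] [MetrizableSpace M] (f : G → M), Continuous f →
    ∃ (H : Type u) (_ : Group H) (_ : TopologicalSpace H) (_ : IsTopologicalGroup H)
      (_ : MetrizableSpace H) (π : G →* H) (g : H → M),
      Continuous π ∧ Function.Surjective π ∧ Continuous g ∧ f = g ∘ π

/-- `PSM`-factorizable groups: as for `IsSMFactorizable`, but with the homomorphism perfect. -/
def IsPSMFactorizable (G : Type u) [Group G] [TopologicalSpace G] : Prop :=
  ∀ (M : Type u) [TopologicalSpace M] [MetrizableSpace M] (f : G → M), Continuous f →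
    ∃ (H : Type u) (_ : Group H) (_ : TopologicalSpace H) (_ : IsTopologicalGroup H)
      (_ : MetrizableSpace H) (π : G →* H) (g : H → M),
      IsPerfectMap π ∧ Continuous g ∧ f = g ∘ π

open Filter Topology

/-! A map `h` to the Hilbert cube records the countable character of `K` near `k ∈ K`. Factoring
`(h, f)` jointly gives `π` such that preimages of neighborhoods of `π k` shrink to the compact set
`K`; translations carry this to every point of `H`, so `π` is proper. Conversely, a fiber of a
perfect `π` witnesses featheredness. -/

/-- An ultrafilter finer than the neighborhood filter of a compact set converges in that set. -/
theorem IsCompact.exists_ultrafilter_le_nhds {X : Type*} [TopologicalSpace X] {K : Set X}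
    (hK : IsCompact K) (F : Ultrafilter X) (hF : (F : Filter X) ≤ 𝓝ˢ K) :
    ∃ x ∈ K, (F : Filter X) ≤ 𝓝 x := by
  by_contra! h
  have hdisj : Disjoint (𝓝ˢ K) (F : Filter X) :=
    hK.disjoint_nhdsSet_left.2 fun x hx =>
      (Ultrafilter.disjoint_iff_not_le.2 (h x hx)).symm
  exact F.neBot.ne (hdisj.eq_bot_of_ge hF)

/-- In a completely regular space, a set of countable character is cut out near each of its
points by a continuous map to the Hilbert cube. -/
theorem HasCountableCharacter.exists_continuous_comap_nhds_le {X : Type*} [TopologicalSpace X]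
    [CompletelyRegularSpace X] {K : Set X} (hK : HasCountableCharacter K) {k : X} (hk : k ∈ K) :
    ∃ h : X → ℕ → unitInterval, Continuous h ∧ comap h (𝓝 (h k)) ≤ 𝓝ˢ K := by
  obtain ⟨B, hB, hBK, hbasis⟩ := hK
  obtain ⟨U₀, hU₀, -⟩ := hbasis Set.univ isOpen_univ (Set.subset_univ K)
  obtain ⟨U, rfl⟩ := hB.exists_eq_range ⟨U₀, hU₀⟩
  have hsep (n : ℕ) := CompletelyRegularSpace.completely_regular k (U n)ᶜ
    (hBK (U n) ⟨n, rfl⟩).1.isClosed_compl (fun hn => hn ((hBK (U n) ⟨n, rfl⟩).2 hk))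
  choose φ hφ hφk hφU using hsep
  refine ⟨fun x n => φ n x, continuous_pi hφ, fun W hW => ?_⟩
  obtain ⟨O, hO, hKO, hOW⟩ := mem_nhdsSet_iff_exists.1 hW
  obtain ⟨_, ⟨n, rfl⟩, hUO⟩ := hbasis O hO hKO
  -- `φ n` is `0` at `k` and `1` off `U n`.
  refine ⟨{y | y n < 1}, (isOpen_lt (continuous_apply n) continuous_const).mem_nhds ?_,
    fun x hx => hOW (hUO ?_)⟩
  · simp [hφk]
  · by_contra hxU
    exact (ne_of_lt hx) (hφU n hxU)

/-- The preimage of a point under a closed map to a first countable space has countable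
character. -/
theorem IsClosedMap.hasCountableCharacter_fiber {X Y : Type*} [TopologicalSpace X]
    [TopologicalSpace Y] [FirstCountableTopology Y] {f : X → Y} (hf : Continuous f)
    (hfc : IsClosedMap f) (y : Y) : HasCountableCharacter (f ⁻¹' {y}) := by
  obtain ⟨V, hV⟩ := (𝓝 y).exists_antitone_basis
  refine ⟨Set.range fun n => f ⁻¹' interior (V n), Set.countable_range _, ?_, fun W hW hyW => ?_⟩
  · rintro _ ⟨n, rfl⟩
    refine ⟨isOpen_interior.preimage hf, Set.preimage_mono ?_⟩
    exact Set.singleton_subset_iff.2 (mem_interior_iff_mem_nhds.2 (hV.mem n))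
  -- These are the points whose fibers lie in `W`.
  · have hO : (f '' Wᶜ)ᶜ ∈ 𝓝 y := by
      refine (hfc _ hW.isClosed_compl).isOpen_compl.mem_nhds ?_
      rintro ⟨x, hx, hxy⟩
      exact hx (hyW hxy)
    obtain ⟨n, hn⟩ := hV.mem_iff.1 hO
    refine ⟨_, ⟨n, rfl⟩, fun x hx => ?_⟩
    by_contra hxW
    exact hn (interior_subset hx) ⟨x, hxW, rfl⟩

/-- A continuous surjective homomorphism to a Hausdorff group is proper as soon as the preimages
of the neighborhoods of one point shrink to a compact set. -/
theorem MonoidHom.isProperMap_of_comap_nhds_le {G H : Type*} [Group G] [TopologicalSpace G]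
    [IsTopologicalGroup G] [Group H] [TopologicalSpace H] [IsTopologicalGroup H] [T2Space H]
    (π : G →* H) (hπ : Continuous π) (hsurj : Function.Surjective π) {K : Set G}
    (hK : IsCompact K) (k : G) (hle : comap π (𝓝 (π k)) ≤ 𝓝ˢ K) : IsProperMap π := by
  refine isProperMap_iff_ultrafilter.2 ⟨hπ, fun F y hF => ?_⟩
  obtain ⟨a, rfl⟩ := hsurj y
  -- Left translation by `k * a⁻¹` moves the limit `π a` to `π k`.
  have htrans : Tendsto (fun x => π (k * a⁻¹ * x)) F (𝓝 (π k)) := by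
    simpa using hF.const_mul (π (k * a⁻¹))
  obtain ⟨x, -, hx⟩ := hK.exists_ultrafilter_le_nhds (F.map (k * a⁻¹ * ·))
    (le_trans (tendsto_comap_iff.2 htrans) hle)
  have hlim : (F : Filter G) ≤ 𝓝 ((k * a⁻¹)⁻¹ * x) := by
    have hx' : Tendsto (k * a⁻¹ * ·) (F : Filter G) (𝓝 x) := hx
    have := hx'.const_mul (k * a⁻¹)⁻¹
    simpa only [Tendsto, inv_mul_cancel_left, map_id'] using this
  exact ⟨_, tendsto_nhds_unique (hπ.continuousAt.mono_left hlim) hF, hlim⟩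

theorem IsPerfectMap.of_isProperMap {X Y : Type*} [TopologicalSpace X] [TopologicalSpace Y]
    {f : X → Y} (hf : IsProperMap f) (hsurj : Function.Surjective f) : IsPerfectMap f where
  continuous := hf.continuous
  isClosedMap := hf.isClosedMap
  surjective := hsurj
  isCompact_fiber := (isProperMap_iff_isClosedMap_and_compact_fibers.1 hf).2.2

theorem theorem6p5 (G : Type u) [Group G] [TopologicalSpace G] [IsTopologicalGroup G]
    [T2Space G] : IsPSMFactorizable G ↔ IsFeathered G ∧ IsSMFactorizable G := by
  constructor
  · refine fun hG => ⟨?_, fun M _ _ f hf => ?_⟩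
    · obtain ⟨H, _, _, _, _, π, -, hπ, -⟩ := hG PUnit (fun _ => PUnit.unit) continuous_const
      exact ⟨π ⁻¹' {1}, ⟨1, map_one π⟩, hπ.isCompact_fiber 1,
        hπ.isClosedMap.hasCountableCharacter_fiber hπ.continuous 1⟩
    · obtain ⟨H, _, _, _, _, π, g, hπ, hg, hfg⟩ := hG M f hf
      exact ⟨H, _, _, ‹_›, ‹_›, π, g, hπ.continuous, hπ.surjective, hg, hfg⟩
  · rintro ⟨⟨K, ⟨k, hk⟩, hKc, hK⟩, hG⟩ M _ _ f hf
    -- The uniformity makes `G` completely regular.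
    let _ : UniformSpace G := IsTopologicalGroup.rightUniformSpace G
    obtain ⟨h, hh, hhK⟩ := hK.exists_continuous_comap_nhds_le hk
    obtain ⟨H, _, _, _, _, π, g, hπ, hsurj, hg, hfg⟩ :=
      hG ((ℕ → unitInterval) × M) (fun x => (h x, f x)) (hh.prodMk hf)
    have hhg : h = (Prod.fst ∘ g) ∘ π := funext fun x => congrArg Prod.fst (congrFun hfg x)
    have hle : comap π (𝓝 (π k)) ≤ 𝓝ˢ K := by
      refine le_trans ?_ hhK
      rw [hhg, ← comap_comap]
      exact comap_mono (map_le_iff_le_comap.1 (continuous_fst.comp hg).continuousAt)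
    exact ⟨H, _, _, ‹_›, ‹_›, π, Prod.snd ∘ g,
      .of_isProperMap (π.isProperMap_of_comap_nhds_le hπ hsurj hKc k hle) hsurj,
      continuous_snd.comp hg, funext fun x => congrArg Prod.snd (congrFun hfg x)⟩
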